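/- Conventions. A permutation is a finite word of distinct positive integers; $S_n$ is the set of permutations $\pi=\pi_1\cdots\pi_n$ of $\{1,\dots,n\}$. West's stack-sorting map $s$ sends the empty word to itself and satisfies $s(LnR)=s(L)\,s(R)\,n$, where $n$ is the largest entry of $LnR$. A permutation is uniquely sorted if it has exactly one preimage under $s$. Let $\mathcal U_n(231,312)$ be the set of uniquely sorted permutations in $S_n$ that avoid the patterns $231$ and $312$. The descent set of $\pi\in S_n$ is $\mathrm{Des}(\pi)=\{i\in\{1,\dots,n-1\}:\pi_i>\pi_{i+1}\}$, and $\mathrm{rot}(\pi)$ is the reverse of the word of $\pi^{-1}$. For $\pi\in S_{2k+1}$ put $\mathrm{DL}_k(\pi)=(\Lambda,\Lambda')$, where $\Lambda=\Lambda_1\cdots\Lambda_{2k}$ and $\Lambda'=\Lambda'_1\cdots\Lambda'_{2k}$ are the words over $\{U,D\}$ with $\Lambda_i=D$ if $2k+1-i\in\mathrm{Des}(\pi)$ and $\Lambda_i=U$ otherwise, and $\Lambda'_i=U$ if $i\in\mathrm{Des}(\mathrm{rot}(\pi))$ and $\Lambda'_i=D$ otherwise. Let $\mathbf D_k$ be the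 set of Dyck paths of semilength $k$, written as words over $\{U,D\}$; let $\mathcal A_k$ be the antichain on $\mathbf D_k$ (the poset in which $\Lambda\le\Lambda'$ only if $\Lambda=\Lambda'$), and let $\mathrm{Int}(\mathcal A_k)$ be the set of its intervals, i.e. pairs $(\Lambda,\Lambda')$ of elements with $\Lambda\le\Lambda'$; these are the pairs $(\Lambda,\Lambda)$ with $\Lambda\in\mathbf D_k$. A permutation is layered if it is a direct sum $\delta_{a_1}\oplus\cdots\oplus\delta_{a_m}$ with all $a_j\ge 1$, where $\delta_a=a(a-1)\cdots1$. Theorem. For every integer $k\ge 0$, the map $\mathrm{DL}_k$ restricts to a bijection from $\mathcal U_{2k+1}(231,312)$ onto $\mathrm{Int}(\mathcal A_k)$. Hence $|\mathcal U_{2k+1}(231,312)|=C_k$, where $C_k=\frac1{k+1}\binom{2k}{k}$ is the $k$-th Catalan number. Moreover, $\mathcal U_{2k+1}(231,312)$ is exactly the set of layered uniquely sorted permutations in $S_{2k+1}$. -/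

import Mathlib

/-! Words, permutations in one-line notation, and the stack-sorting map -/

/-- A permutation: a finite word of positive integers without repeated letters. -/
def IsPermutation (π : List ℕ) : Prop := π.Nodup ∧ ∀ x ∈ π, 0 < x

/-- `S_n`: the permutations of `{1, …, n}`, in one-line notation. -/
def permutationsOf (n : ℕ) : Set (List ℕ) := {π | π.Perm (List.range' 1 n)}

/-- The entry `π_i` of a word, with positions counted from `1`. -/
def entry (π : List ℕ) (i : ℕ) : ℕ := π.getD (i - 1) 0

/-- The largest entry of a word (and `0` for the empty word). -/
def maxEntry (π : List ℕ) : ℕ := π.foldr max 0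

theorem maxEntry_mem : ∀ {π : List ℕ}, π ≠ [] → maxEntry π ∈ π
  | [], h => absurd rfl h
  | [a], _ => by simp [maxEntry]
  | a :: b :: l, _ => by
    have ih : maxEntry (b :: l) ∈ b :: l := maxEntry_mem (by simp)
    have h : maxEntry (a :: b :: l) = max a (maxEntry (b :: l)) := rfl
    rcases max_choice a (maxEntry (b :: l)) with h' | h'
    · rw [h, h']; exact List.mem_cons_self
    · rw [h, h']; exact List.mem_cons_of_mem _ ih

/-- West's stack-sorting map: the empty word is sent to itself, and `s (L n R) = s(L) s(R) n`
where `n` is the largest entry. -/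
def stackSort (π : List ℕ) : List ℕ :=
  if _h : π = [] then [] else
    stackSort (π.take (π.idxOf (maxEntry π))) ++
      stackSort (π.drop (π.idxOf (maxEntry π) + 1)) ++ [maxEntry π]
termination_by π.length
decreasing_by
  · have := List.idxOf_lt_length_of_mem (maxEntry_mem _h)
    simp only [List.length_take]
    omega
  · have := List.length_pos_of_ne_nil _h
    simp only [List.length_drop]
    omega

/-- A permutation is uniquely sorted if it has exactly one preimage under the stack-sorting map
(that is, its fertility is `1`). -/
def IsUniquelySorted (π : List ℕ) : Prop :=
  {σ : List ℕ | IsPermutation σ ∧ stackSort σ = π}.encard = 1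

/-! Patterns -/

/-- Replace the `i`-th smallest entry of a permutation by `i`, for every `i`. -/
def normalization (π : List ℕ) : List ℕ := π.map fun x => π.countP (· ≤ x)

/-- `σ` contains the pattern `τ`: some subsequence of `σ` has the same relative order as `τ`. -/
def ContainsPattern (σ τ : List ℕ) : Prop :=
  ∃ w : List ℕ, w.Sublist σ ∧ normalization w = normalization τ

/-- `𝒰_n(τ⁽¹⁾, …, τ⁽ʳ⁾)`: the uniquely sorted permutations in `S_n` that avoid all the
patterns in the given list. -/
def uniquelySorted (n : ℕ) (patterns : List (List ℕ)) : Set (List ℕ) :=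
  {π | π ∈ permutationsOf n ∧ IsUniquelySorted π ∧ ∀ τ ∈ patterns, ¬ ContainsPattern π τ}

/-! Layered permutations -/

/-- The direct sum `σ ⊕ τ`: the plot of `τ` is placed above and to the right of that of `σ`. -/
def directSum (σ τ : List ℕ) : List ℕ := σ ++ τ.map (· + σ.length)

/-- The decreasing permutation `δ_a = a (a-1) ⋯ 1`. -/
def decreasingPerm (a : ℕ) : List ℕ := (List.range' 1 a).reverse

/-- Layered permutations: `δ_{a_1} ⊕ δ_{a_2} ⊕ ⋯ ⊕ δ_{a_m}` with positive `a_1, …, a_m`. -/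
def IsLayered (π : List ℕ) : Prop :=
  ∃ a : List ℕ, (∀ x ∈ a, 0 < x) ∧ π = (a.map decreasingPerm).foldr directSum []

/-! The map `DL_k` -/

/-- The set of descents of `π`: indices `1 ≤ i ≤ n - 1` with `π_i > π_{i+1}`. -/
def descents (π : List ℕ) : Finset ℕ :=
  (Finset.Icc 1 (π.length - 1)).filter fun i => entry π (i + 1) < entry π i

/-- The inverse of `π ∈ S_n`: its `j`-th entry is the position of `j` in `π`. -/
def inversePerm (π : List ℕ) : List ℕ :=
  (List.range' 1 π.length).map fun j => π.idxOf j + 1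

/-- `rot(π) = rev(π⁻¹)`: the plot of `π` rotated counterclockwise by 90 degrees. -/
def rot (π : List ℕ) : List ℕ := (inversePerm π).reverse

/-- `DL_k(π) = (Λ, Λ')` for `π ∈ S_n`, `n = 2k+1`: both words have length `2k`; the letter `Λ_i` is
`D` if `n - i ∈ Des(π)` and `U` otherwise; the letter `Λ'_i` is `U` if `i ∈ Des(rot(π))` and `D`
otherwise. -/
def DL (k : ℕ) (π : List ℕ) : List DyckStep × List DyckStep :=
  ((List.range' 1 (2 * k)).map fun i =>
      if 2 * k + 1 - i ∈ descents π then DyckStep.D else DyckStep.U,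
   (List.range' 1 (2 * k)).map fun i =>
      if i ∈ descents (rot π) then DyckStep.U else DyckStep.D)

/-! The Catalan antichain -/

/-- `𝐃_k`, the Dyck paths of semilength `k`, as the ground set of the antichain `𝒜_k`. -/
structure CatalanAntichain (k : ℕ) where
  /-- the underlying Dyck path -/
  path : DyckWord
  semilength_eq : path.semilength = k

/-- `𝒜_k` is an antichain: `Λ ≤ Λ'` only if `Λ = Λ'`. -/
instance (k : ℕ) : PartialOrder (CatalanAntichain k) where
  le x y := x = y
  le_refl _ := rfl
  le_trans _ _ _ h₁ h₂ := h₁.trans h₂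
  le_antisymm _ _ h _ := h

/-- `Int(𝒜_k)`: the pairs `(x, y)` of elements of `𝒜_k` with `x ≤ y`, each Dyck path being
written as a word over `{U, D}`. -/
def antichainIntervals (k : ℕ) : Set (List DyckStep × List DyckStep) :=
  {w | ∃ x y : CatalanAntichain k, x ≤ y ∧ w = (x.path.toList, y.path.toList)}

open DyckStep

/-! Read `π` from right to left, writing `U` for each descent of the reversed word and `D`
otherwise; for a permutation in S_{2k+1} this is the word Λ. Since s(LnR) = s(L) s(R) n, a reversed
image is n, then reversed s(R), then reversed s(L). When L and R are nonempty its word is U v x u,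
with v and u the words of the two parts. By induction the word of every sorted permutation is a
ballot word (`isBallot_comparisonWord_of_stackSort`).

Conversely, if `π` avoids 312 and its word is ballot, a preimage is built by cutting at the first
return to height zero; if the final height is positive, a second preimage appears
(`exists_stackSort_eq`). If the final height is zero, every preimage must cut at the first return,
so it is unique (`eq_of_stackSort_eq_of_count_eq`). Hence a 312-avoider is uniquely sorted exactly
when its word is a Dyck word (`isUniquelySorted_reverse_iff`).

Avoiding 231 and 312 means being layered (`isLayered_iff_of_mem_permutationsOf`). Layered
permutations are involutions, so rot is mere reversal and Λ = Λ'. The layer sizes form a composition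
of 2k+1, and compositions of 2k+1 correspond bijectively to words of length 2k over {U, D}. -/

/-! ### Basic properties of the stack-sorting map. -/

theorem le_maxEntry {π : List ℕ} {x : ℕ} (h : x ∈ π) : x ≤ maxEntry π := by
  induction π with
  | nil => simp at h
  | cons a l ih =>
    have e : maxEntry (a :: l) = max a (maxEntry l) := rfl
    rw [e]
    rcases List.mem_cons.1 h with rfl | h
    · exact le_max_left _ _
    · exact (ih h).trans (le_max_right _ _)

theorem maxEntry_eq_of_forall_le {π : List ℕ} {n : ℕ} (hn : n ∈ π) (h : ∀ x ∈ π, x ≤ n) :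
    maxEntry π = n :=
  le_antisymm (h _ (maxEntry_mem (List.ne_nil_of_mem hn))) (le_maxEntry hn)

theorem stackSort_nil : stackSort [] = [] := by
  rw [stackSort]; simp

theorem stackSort_append_cons {L R : List ℕ} {n : ℕ} (hL : ∀ x ∈ L, x < n) (hR : ∀ x ∈ R, x ≤ n) :
    stackSort (L ++ n :: R) = stackSort L ++ stackSort R ++ [n] := by
  have hm : maxEntry (L ++ n :: R) = n := by
    apply maxEntry_eq_of_forall_le (by simp)
    intro x hx
    rcases List.mem_append.1 hx with hx | hx
    · exact (hL x hx).le
    · rcases List.mem_cons.1 hx with rfl | hx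
      · exact le_rfl
      · exact hR x hx
  have hi : (L ++ n :: R).idxOf n = L.length := by
    rw [List.idxOf_append_of_notMem fun h => (hL n h).false]; simp
  rw [stackSort, dif_neg (by simp), hm, hi]
  simp

theorem exists_eq_append_cons_of_ne_nil {σ : List ℕ} (h : σ ≠ []) :
    ∃ L R, σ = L ++ maxEntry σ :: R ∧
      stackSort σ = stackSort L ++ stackSort R ++ [maxEntry σ] := by
  refine ⟨σ.take (σ.idxOf (maxEntry σ)), σ.drop (σ.idxOf (maxEntry σ) + 1), ?_,
    by rw [stackSort, dif_neg h]⟩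
  have hlt := List.idxOf_lt_length_of_mem (maxEntry_mem h)
  conv_lhs => rw [← List.take_append_drop (σ.idxOf (maxEntry σ)) σ, List.drop_eq_getElem_cons hlt]
  simp

theorem stackSort_perm (σ : List ℕ) : (stackSort σ).Perm σ := by
  induction h : σ.length using Nat.strong_induction_on generalizing σ with
  | _ m ih =>
    rcases eq_or_ne σ [] with rfl | hσ
    · rw [stackSort_nil]
    · obtain ⟨L, R, h1, h2⟩ := exists_eq_append_cons_of_ne_nil hσ
      have hl := congrArg List.length h1
      simp only [List.length_append, List.length_cons] at hl
      have pL := ih L.length (by omega) L rfl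
      have pR := ih R.length (by omega) R rfl
      rw [h2]
      conv_rhs => rw [h1]
      rw [List.append_assoc]
      exact pL.append ((pR.append_right _).trans (List.perm_append_singleton _ _))

theorem stackSort_eq_nil_iff {σ : List ℕ} : stackSort σ = [] ↔ σ = [] :=
  ⟨fun h => by have := stackSort_perm σ; rw [h] at this; exact this.symm.eq_nil,
   fun h => h ▸ stackSort_nil⟩

theorem exists_of_stackSort_eq_append_singleton {σ π : List ℕ} {n : ℕ}
    (h : stackSort σ = π ++ [n]) :
    ∃ L R, σ = L ++ n :: R ∧ stackSort L ++ stackSort R = π ∧ ∀ x ∈ π, x ≤ n := by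
  have hσ : σ ≠ [] := by rintro rfl; simp [stackSort_nil] at h
  obtain ⟨L, R, h1, h2⟩ := exists_eq_append_cons_of_ne_nil hσ
  rw [h] at h2
  obtain ⟨h3, h4⟩ := List.append_inj' h2 rfl
  simp only [List.cons.injEq, and_true] at h4
  rw [← h4] at h1
  refine ⟨L, R, h1, h3.symm, fun x hx => ?_⟩
  rw [h4]
  apply le_maxEntry
  rw [← (stackSort_perm σ).mem_iff, h]
  simp [hx]

/-! ### Comparison words and ballot words. -/

/-- The comparisons of consecutive entries of a word: `U` for each descent. -/
def comparisonWord : List ℕ → List DyckStep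
  | a :: b :: l => (if b < a then U else D) :: comparisonWord (b :: l)
  | _ => []

/-- Every prefix has at least as many `U`s as `D`s. -/
def IsBallot (w : List DyckStep) : Prop := ∀ i, (w.take i).count D ≤ (w.take i).count U

theorem length_comparisonWord : ∀ l : List ℕ, (comparisonWord l).length = l.length - 1
  | [] => rfl
  | [_] => rfl
  | a :: b :: l => by simp [comparisonWord, length_comparisonWord (b :: l)]

theorem comparisonWord_append_cons_cons (A B : List ℕ) (a b : ℕ) :
    comparisonWord (A ++ a :: b :: B) =
      comparisonWord (A ++ [a]) ++ (if b < a then U else D) :: comparisonWord (b :: B) := by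
  induction A with
  | nil => simp [comparisonWord]
  | cons c A ih =>
    cases A with
    | nil => simp [comparisonWord]
    | cons d A => simpa [comparisonWord] using ih

theorem exists_comparisonWord_append {A B : List ℕ} (hA : A ≠ []) (hB : B ≠ []) :
    ∃ x, comparisonWord (A ++ B) = comparisonWord A ++ x :: comparisonWord B := by
  obtain ⟨A, a, rfl⟩ := (List.eq_nil_or_concat A).resolve_left hA
  obtain ⟨b, B, rfl⟩ := List.exists_cons_of_ne_nil hB
  refine ⟨_, by simpa using comparisonWord_append_cons_cons A B a b⟩

theorem exists_of_comparisonWord_eq_append {l : List ℕ} {v u : List DyckStep} {x : DyckStep}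
    (h : comparisonWord l = v ++ x :: u) :
    ∃ A B, A ≠ [] ∧ B ≠ [] ∧ l = A ++ B ∧ comparisonWord A = v ∧ comparisonWord B = u := by
  have hlen := congrArg List.length h
  simp only [length_comparisonWord, List.length_append, List.length_cons] at hlen
  have hA : l.take (v.length + 1) ≠ [] := by
    rw [← List.length_pos_iff, List.length_take]; omega
  have hB : l.drop (v.length + 1) ≠ [] := by
    rw [← List.length_pos_iff, List.length_drop]; omega
  obtain ⟨y, hy⟩ := exists_comparisonWord_append hA hB
  rw [List.take_append_drop, h] at hy
  obtain ⟨h1, h2⟩ := List.append_inj hy (by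
    rw [length_comparisonWord, List.length_take]; omega)
  exact ⟨_, _, hA, hB, (List.take_append_drop _ _).symm, h1.symm, (List.cons.inj h2).2.symm⟩

theorem IsBallot.count_le {w : List DyckStep} (h : IsBallot w) : w.count D ≤ w.count U := by
  simpa using h w.length

theorem IsBallot.cons_U {w : List DyckStep} (h : IsBallot w) : IsBallot (U :: w) := by
  rintro (_ | i)
  · simp
  · have := h i
    simp; omega

/-- The leading `U` pays for `x`, even when `x = D`. -/
theorem IsBallot.cons_U_append_cons {v u : List DyckStep} (hv : IsBallot v) (hu : IsBallot u)
    (x : DyckStep) : IsBallot (U :: (v ++ x :: u)) := by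
  rintro (_ | i)
  · simp
  · have h1 := hv i
    have h2 := hu (i - v.length - 1)
    rw [List.take_succ_cons, List.take_append]
    obtain h | ⟨t, h⟩ : i - v.length = 0 ∨ ∃ t, i - v.length = t + 1 := by
      rcases i - v.length with _ | t
      · simp
      · simp
    · simp [h]; omega
    · rw [h] at h2
      cases x <;> simp [h] at h2 ⊢ <;> omega

theorem IsBallot.right_of_cons_U {v u : List DyckStep} (h : IsBallot (U :: (v ++ D :: u)))
    (hv : v.count D = v.count U) : IsBallot u := fun i => by
  have := h (v.length + 1 + i + 1)
  rw [List.take_succ_cons, List.take_append, List.take_of_length_le (by omega),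
    show v.length + 1 + i - v.length = i + 1 by omega] at this
  simp at this
  omega

/-- The shortest prefix of `w` that goes below zero ends in a `D`, and what precedes that `D` is
balanced. In `U :: w` this is the first return to height zero. -/
theorem exists_first_return {w : List DyckStep} (h : IsBallot (U :: w)) (hw : ¬ IsBallot w) :
    ∃ v u, w = v ++ D :: u ∧ IsBallot v ∧ v.count D = v.count U ∧ IsBallot u := by
  classical
  unfold IsBallot at hw
  push Not at hw
  have hmin := fun m (hm : m < Nat.find hw) => Nat.find_min hw hm
  have hspec := Nat.find_spec hw
  generalize Nat.find hw = i at hmin hspec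
  obtain _ | i := i
  · simp at hspec
  -- Taking more letters than `w` has gives `w` again, so a minimal failing prefix ends inside `w`.
  have hi : i < w.length := by
    by_contra hc
    apply hmin i (by omega)
    rwa [List.take_of_length_le (by omega)] at hspec ⊢
  have hb : IsBallot (w.take i) := fun j => by
    rw [List.take_take]
    exact not_lt.1 (hmin (min j i) (by omega))
  have hle := hb.count_le
  have htake : w.take (i + 1) = w.take i ++ [w[i]] := (List.take_concat_get' w i hi).symm
  rw [htake] at hspec
  have hD : w[i] = D := by
    rcases h : w[i] with _ | _
    · rw [h] at hspec; simp at hspec; omega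
    · rfl
  rw [hD] at hspec
  have he : (w.take i).count D = (w.take i).count U := by simp at hspec; omega
  have hw' : w = w.take i ++ D :: w.drop (i + 1) := by
    conv_lhs => rw [← List.take_append_drop i w, List.drop_eq_getElem_cons hi, hD]
  refine ⟨_, _, hw', hb, he, ?_⟩
  rw [hw'] at h
  exact h.right_of_cons_U he

/-! ### Counting preimages by means of the ballot word. -/

/-- No inversion `a > b` is followed by an entry above `a`: the word avoids `213`, so that the
reversed word avoids `312`. -/
def NoRise (l : List ℕ) : Prop := ∀ a b x, [a, b, x].Sublist l → b < a → x ≤ a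

theorem NoRise.sublist {l l' : List ℕ} (h : NoRise l) (hs : l'.Sublist l) : NoRise l' :=
  fun a b x hx => h a b x (hx.trans hs)

theorem isBallot_comparisonWord_of_stackSort {σ l : List ℕ} (hl : l ≠ []) (hd : l.Nodup)
    (h : stackSort σ = l.reverse) : IsBallot (comparisonWord l) := by
  induction hm : l.length using Nat.strong_induction_on generalizing σ l with
  | _ m ih =>
    obtain ⟨n, l, rfl⟩ := List.exists_cons_of_ne_nil hl
    rw [List.reverse_cons] at h
    obtain ⟨L, R, -, h2, h3⟩ := exists_of_stackSort_eq_append_singleton h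
    rw [List.length_cons] at hm
    rw [List.nodup_cons] at hd
    rcases l with _ | ⟨b, l⟩
    · intro i; simp [comparisonWord]
    have hb : b < n := lt_of_le_of_ne (h3 b (by simp)) (by rintro rfl; simp at hd)
    rw [comparisonWord, if_pos hb]
    have e := congrArg List.reverse h2
    rw [List.reverse_append, List.reverse_reverse] at e
    have hlen := congrArg List.length e
    simp only [List.length_append, List.length_reverse] at hlen
    by_cases hR : R = []
    · refine (ih _ (by omega) (σ := L) (by simp) hd.2 ?_ rfl).cons_U
      simpa [hR, stackSort_nil] using h2
    by_cases hL : L = []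
    · refine (ih _ (by omega) (σ := R) (by simp) hd.2 ?_ rfl).cons_U
      simpa [hL, stackSort_nil] using h2
    have hR' : (stackSort R).reverse ≠ [] := by simpa [stackSort_eq_nil_iff] using hR
    have hL' : (stackSort L).reverse ≠ [] := by simpa [stackSort_eq_nil_iff] using hL
    have pR := List.length_pos_iff.2 hR'
    have pL := List.length_pos_iff.2 hL'
    rw [List.length_reverse] at pR pL
    rw [← e, List.nodup_append] at hd
    obtain ⟨x, hx⟩ := exists_comparisonWord_append hR' hL'
    rw [← e, hx]
    exact .cons_U_append_cons
      (ih _ (by simp; omega) hR' hd.2.1 (List.reverse_reverse _).symm rfl)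
      (ih _ (by simp; omega) hL' hd.2.2.1 (List.reverse_reverse _).symm rfl) x

theorem forall_lt_of_isBallot {n : ℕ} {l : List ℕ} (hd : (n :: l).Nodup) (hN : NoRise (n :: l))
    (hB : IsBallot (comparisonWord (n :: l))) : ∀ x ∈ l, x < n := by
  rcases l with _ | ⟨b, l⟩
  · simp
  have hb : b < n := by
    by_contra hb
    have := hB 1
    simp [comparisonWord, hb] at this
  intro x hx
  rcases List.mem_cons.1 hx with rfl | hx
  · exact hb
  · refine lt_of_le_of_ne (hN n b x ?_ hb) ?_
    · simpa using hx
    · rintro rfl; simp [hx] at hd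

theorem stackSort_append_cons_of_reverse {n : ℕ} {L R A B : List ℕ} (hL : stackSort L = A.reverse)
    (hR : stackSort R = B.reverse) (hlt : ∀ x ∈ B ++ A, x < n) :
    stackSort (L ++ n :: R) = (n :: (B ++ A)).reverse := by
  rw [stackSort_append_cons, hL, hR]
  · simp
  · intro x hx
    rw [← (stackSort_perm L).mem_iff, hL] at hx
    exact hlt x (by simp at hx; simp [hx])
  · intro x hx
    rw [← (stackSort_perm R).mem_iff, hR] at hx
    exact (hlt x (by simp at hx; simp [hx])).le

theorem eq_and_eq_of_append_cons {n : ℕ} {L R L' R' : List ℕ} (hL : ∀ x ∈ L, x ≠ n)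
    (hL' : ∀ x ∈ L', x ≠ n) (h : L ++ n :: R = L' ++ n :: R') : L = L' ∧ R = R' := by
  have h1 := congrArg (List.idxOf n) h
  rw [List.idxOf_append_of_notMem fun h => hL n h rfl,
    List.idxOf_append_of_notMem fun h => hL' n h rfl] at h1
  simp only [List.idxOf_cons_self, add_zero] at h1
  obtain ⟨h2, h3⟩ := List.append_inj h h1
  exact ⟨h2, (List.cons.inj h3).2⟩

theorem ne_of_stackSort_eq_reverse {n : ℕ} {L A : List ℕ} (hL : stackSort L = A.reverse)
    (hlt : ∀ x ∈ A, x < n) : ∀ x ∈ L, x ≠ n := by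
  intro x hx
  rw [← (stackSort_perm L).mem_iff, hL, List.mem_reverse] at hx
  exact (hlt x hx).ne

/-- A word avoiding `312` whose reversed comparison word is a ballot word is sorted, and has
two preimages unless that ballot word returns to height zero. -/
theorem exists_stackSort_eq {l : List ℕ} (hl : l ≠ []) (hd : l.Nodup) (hN : NoRise l)
    (hB : IsBallot (comparisonWord l)) :
    ∃ σ σ', stackSort σ = l.reverse ∧ stackSort σ' = l.reverse ∧
      ((comparisonWord l).count D < (comparisonWord l).count U → σ ≠ σ') := by
  induction hm : l.length using Nat.strong_induction_on generalizing l with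
  | _ m ih =>
    obtain ⟨n, l, rfl⟩ := List.exists_cons_of_ne_nil hl
    have hlt := forall_lt_of_isBallot hd hN hB
    rw [List.length_cons] at hm
    rcases l with _ | ⟨b, l⟩
    · have h1 : stackSort [n] = [n] := by
        simpa [stackSort_nil] using stackSort_append_cons (L := []) (R := []) (n := n)
      exact ⟨[n], [n], by simpa using h1, by simpa using h1, by simp [comparisonWord]⟩
    have hN' := hN.sublist (List.sublist_cons_self n (b :: l))
    have hd' := (List.nodup_cons.1 hd).2
    rw [comparisonWord, if_pos (hlt b (by simp))] at hB ⊢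
    by_cases hB' : IsBallot (comparisonWord (b :: l))
    · obtain ⟨σ, -, hσ, -⟩ := ih _ (by omega) (by simp) hd' hN' hB' rfl
      -- The maximum may stand at either end of a preimage of the rest; the results differ because
      -- `σ` is nonempty.
      refine ⟨σ ++ n :: [], [] ++ n :: σ, ?_, ?_, fun _ h => ?_⟩
      · exact stackSort_append_cons_of_reverse (B := []) hσ (by simp [stackSort_nil]) hlt
      · simpa using stackSort_append_cons_of_reverse (L := []) (A := []) (by simp [stackSort_nil]) hσ
          (by simpa using hlt)
      · have hs := eq_and_eq_of_append_cons (ne_of_stackSort_eq_reverse hσ hlt) (by simp) h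
        rw [hs.1, stackSort_nil] at hσ
        simp at hσ
    · obtain ⟨v, u, hw, hv, hv0, hu⟩ := exists_first_return hB hB'
      obtain ⟨B, A, hBn, hAn, hBA, rfl, rfl⟩ := exists_of_comparisonWord_eq_append hw
      rw [hw]
      rw [hBA] at hN' hd' hlt ⊢
      have hlen := congrArg List.length hBA
      have pA := List.length_pos_iff.2 hAn
      have pB := List.length_pos_iff.2 hBn
      rw [List.length_append] at hlen
      rw [List.nodup_append] at hd'
      obtain ⟨τ, -, hτ, -⟩ := ih _ (by omega) hBn hd'.1
        (hN'.sublist (List.sublist_append_left _ _)) hv rfl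
      obtain ⟨σ, σ', hσ, hσ', hne⟩ := ih _ (by omega) hAn hd'.2.1
        (hN'.sublist (List.sublist_append_right _ _)) hu rfl
      refine ⟨_, _, stackSort_append_cons_of_reverse hσ hτ hlt,
        stackSort_append_cons_of_reverse hσ' hτ hlt, fun hc h => hne ?_ ?_⟩
      -- The prefix U v D has height zero, so the surplus of `U`s lies entirely in the word of `A`.
      · simp at hc; omega
      · have hltA : ∀ x ∈ A, x < n := fun x hx => hlt x (by simp [hx])
        exact (eq_and_eq_of_append_cons (ne_of_stackSort_eq_reverse hσ hltA)
          (ne_of_stackSort_eq_reverse hσ' hltA) h).1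

/-- Were `v'` longer, it would have v D as a prefix, which has height -1. Used in both directions,
this makes the first-return cut unique. -/
theorem length_le_of_append_cons_eq {v v' u u' : List DyckStep} (hv : v.count D = v.count U)
    (hv' : IsBallot v') (h : v ++ D :: u = v' ++ D :: u') : v'.length ≤ v.length := by
  by_contra hlt
  have h1 := congrArg (List.take (v.length + 1)) h
  rw [List.take_append_of_le_length (l₁ := v') (by omega), List.take_append,
    List.take_of_length_le (by omega)] at h1
  have h2 := hv' (v.length + 1)
  rw [← h1] at h2
  simp at h2
  omega

/-- The preimages of a word whose comparison word is a nonempty Dyck path come from its first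
return decomposition. -/
theorem exists_of_stackSort_eq_reverse_of_count_eq {n : ℕ} {l σ : List ℕ} (hl : l ≠ [])
    (hd : (n :: l).Nodup)
    (hc : (comparisonWord (n :: l)).count D = (comparisonWord (n :: l)).count U)
    (h : stackSort σ = (n :: l).reverse) :
    ∃ L R A B, A ≠ [] ∧ B ≠ [] ∧ l = B ++ A ∧ σ = L ++ n :: R ∧ stackSort L = A.reverse ∧
      stackSort R = B.reverse ∧ comparisonWord l = comparisonWord B ++ D :: comparisonWord A ∧
      IsBallot (comparisonWord B) ∧ IsBallot (comparisonWord A) ∧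
      (comparisonWord B).count D = (comparisonWord B).count U ∧
      (comparisonWord A).count D = (comparisonWord A).count U := by
  rw [List.reverse_cons] at h
  obtain ⟨L, R, h1, h2, h3⟩ := exists_of_stackSort_eq_append_singleton h
  rw [List.nodup_cons] at hd
  obtain ⟨b, l, rfl⟩ := List.exists_cons_of_ne_nil hl
  have hb : b < n := lt_of_le_of_ne (h3 b (by simp)) (by rintro rfl; simp at hd)
  rw [comparisonWord, if_pos hb] at hc
  have e := congrArg List.reverse h2
  rw [List.reverse_append, List.reverse_reverse] at e
  -- If `L` or `R` is empty, the word after the leading `U` is itself ballot, so that `U` is never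
  -- cancelled.
  have hR : R ≠ [] := by
    rintro rfl
    have hB := isBallot_comparisonWord_of_stackSort (σ := L) (by simp) hd.2
      (by simpa [stackSort_nil] using h2)
    have := hB.count_le
    simp at hc; omega
  have hL : L ≠ [] := by
    rintro rfl
    have hB := isBallot_comparisonWord_of_stackSort (σ := R) (by simp) hd.2
      (by simpa [stackSort_nil] using h2)
    have := hB.count_le
    simp at hc; omega
  have hR' : (stackSort R).reverse ≠ [] := by simpa [stackSort_eq_nil_iff] using hR
  have hL' : (stackSort L).reverse ≠ [] := by simpa [stackSort_eq_nil_iff] using hL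
  obtain ⟨x, hx⟩ := exists_comparisonWord_append hR' hL'
  rw [e] at hx
  have hdd := hd.2
  rw [← e, List.nodup_append] at hdd
  have bB := isBallot_comparisonWord_of_stackSort hR' hdd.1 (List.reverse_reverse _).symm
  have bA := isBallot_comparisonWord_of_stackSort hL' hdd.2.1 (List.reverse_reverse _).symm
  have cB := bB.count_le
  have cA := bA.count_le
  rw [hx] at hc
  -- The two parts have nonnegative final heights, so total height zero forces `x = D` and both
  -- parts balanced.
  have hxD : x = D := by
    cases x
    · simp at hc; omega
    · rfl
  subst hxD
  simp at hc
  exact ⟨L, R, _, _, hL', hR', e.symm, h1, (List.reverse_reverse _).symm,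
    (List.reverse_reverse _).symm, hx, bB, bA, by omega, by omega⟩

/-- Every preimage splits the word at its first return, so both have the same `A` and `B`; induction
applies to each part. Pattern avoidance plays no role here. -/
theorem eq_of_stackSort_eq_of_count_eq {l σ σ' : List ℕ} (hl : l ≠ []) (hd : l.Nodup)
    (hc : (comparisonWord l).count D = (comparisonWord l).count U)
    (h : stackSort σ = l.reverse) (h' : stackSort σ' = l.reverse) : σ = σ' := by
  induction hm : l.length using Nat.strong_induction_on generalizing l σ σ' with
  | _ m ih =>
    obtain ⟨n, l, rfl⟩ := List.exists_cons_of_ne_nil hl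
    rcases eq_or_ne l [] with rfl | hl'
    · have p := (stackSort_perm σ).symm
      have p' := (stackSort_perm σ').symm
      rw [h] at p
      rw [h'] at p'
      simp only [List.reverse_singleton, List.perm_singleton] at p p'
      rw [p, p']
    obtain ⟨L, R, A, B, hA, hB, hBA, rfl, hL, hR, hw, bB, bA, cB, cA⟩ :=
      exists_of_stackSort_eq_reverse_of_count_eq hl' hd hc h
    obtain ⟨L', R', A', B', hA', hB', hBA', rfl, hL', hR', hw', bB', bA', cB', cA'⟩ :=
      exists_of_stackSort_eq_reverse_of_count_eq hl' hd hc h'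
    have l1 := length_le_of_append_cons_eq cB bB' (hw.symm.trans hw')
    have l2 := length_le_of_append_cons_eq cB' bB (hw'.symm.trans hw)
    have pA := List.length_pos_iff.2 hA
    have pB := List.length_pos_iff.2 hB
    have pB' := List.length_pos_iff.2 hB'
    rw [length_comparisonWord, length_comparisonWord] at l1 l2
    obtain ⟨rfl, rfl⟩ := List.append_inj (hBA.symm.trans hBA') (by omega)
    have hlen := congrArg List.length hBA
    rw [List.length_append] at hlen
    rw [List.length_cons] at hm
    rw [List.nodup_cons, hBA, List.nodup_append] at hd
    rw [ih _ (by omega) hA hd.2.2.1 cA hL hL' rfl, ih _ (by omega) hB hd.2.1 cB hR hR' rfl]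

theorem isUniquelySorted_reverse_iff {l : List ℕ} (hl : l ≠ []) (hd : l.Nodup)
    (hp : ∀ x ∈ l, 0 < x) (hN : NoRise l) :
    IsUniquelySorted l.reverse ↔ IsBallot (comparisonWord l) ∧
      (comparisonWord l).count D = (comparisonWord l).count U := by
  -- A preimage rearranges the same letters, so it is automatically a permutation.
  have hperm : ∀ σ, stackSort σ = l.reverse → IsPermutation σ := fun σ hσ => by
    have p : σ.Perm l := (stackSort_perm σ).symm.trans (hσ ▸ l.reverse_perm)
    exact ⟨p.nodup_iff.2 hd, fun x hx => hp x (p.mem_iff.1 hx)⟩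
  rw [IsUniquelySorted, Set.encard_eq_one]
  constructor
  · rintro ⟨τ, hτ⟩
    have hτ' : IsPermutation τ ∧ stackSort τ = l.reverse := by
      have : τ ∈ ({τ} : Set (List ℕ)) := rfl
      rwa [← hτ] at this
    have hB := isBallot_comparisonWord_of_stackSort hl hd hτ'.2
    refine ⟨hB, hB.count_le.eq_of_not_lt fun hlt => ?_⟩
    obtain ⟨σ, σ', hσ, hσ', hne⟩ := exists_stackSort_eq hl hd hN hB
    have e : ∀ ρ, stackSort ρ = l.reverse → ρ = τ := fun ρ hρ => by
      have : ρ ∈ {σ | IsPermutation σ ∧ stackSort σ = l.reverse} := ⟨hperm ρ hρ, hρ⟩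
      rwa [hτ] at this
    exact hne hlt ((e σ hσ).trans (e σ' hσ').symm)
  · rintro ⟨hB, hc⟩
    obtain ⟨σ, -, hσ, -⟩ := exists_stackSort_eq hl hd hN hB
    refine ⟨σ, Set.eq_singleton_iff_unique_mem.2 ⟨⟨hperm σ hσ, hσ⟩, fun ρ hρ => ?_⟩⟩
    exact eq_of_stackSort_eq_of_count_eq hl hd hc hρ.2 hσ

/-! ### Layered permutations and avoidance of 231 and 312. -/

/-- The word `δ_{a_1} ⊕ ⋯ ⊕ δ_{a_m}` with all entries increased by `c`. -/
def layersFrom : ℕ → List ℕ → List ℕ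
  | _, [] => []
  | c, a :: t => (List.range' (c + 1) a).reverse ++ layersFrom (c + a) t

theorem map_add_layersFrom (d : ℕ) (as : List ℕ) : ∀ c,
    (layersFrom c as).map (· + d) = layersFrom (c + d) as := by
  induction as with
  | nil => intro c; rfl
  | cons a t ih =>
    intro c
    have h : (fun x => x + d) = (d + ·) := by funext x; exact add_comm _ _
    rw [layersFrom, layersFrom, List.map_append, ih, List.map_reverse, h, List.map_add_range']
    congr 2
    · congr 1; omega
    · omega

theorem foldr_directSum_decreasingPerm (as : List ℕ) :
    (as.map decreasingPerm).foldr directSum [] = layersFrom 0 as := by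
  induction as with
  | nil => rfl
  | cons a t ih =>
    rw [List.map_cons, List.foldr_cons, ih, directSum, map_add_layersFrom]
    simp [decreasingPerm, layersFrom]

theorem isLayered_iff {π : List ℕ} :
    IsLayered π ↔ ∃ as : List ℕ, (∀ x ∈ as, 0 < x) ∧ π = layersFrom 0 as := by
  simp only [IsLayered, foldr_directSum_decreasingPerm]

theorem layersFrom_perm (as : List ℕ) : ∀ c,
    (layersFrom c as).Perm (List.range' (c + 1) as.sum) := by
  induction as with
  | nil => intro c; simp [layersFrom]
  | cons a t ih =>
    intro c
    rw [layersFrom, List.sum_cons, ← List.range'_append_1]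
    refine (List.reverse_perm _).append ?_
    convert ih (c + a) using 2
    omega

theorem mem_layersFrom {c x : ℕ} {as : List ℕ} :
    x ∈ layersFrom c as ↔ c < x ∧ x ≤ c + as.sum := by
  rw [(layersFrom_perm as c).mem_iff, List.mem_range'_1]; omega

theorem length_layersFrom (c : ℕ) (as : List ℕ) : (layersFrom c as).length = as.sum := by
  simpa using (layersFrom_perm as c).length_eq

/-- A word in which the entry between the two entries of any inversion has an intermediate value;
for words without repeated letters, this is the avoidance of `231` and `312`. -/
def InversionsConvex (l : List ℕ) : Prop :=
  ∀ x y z, [x, y, z].Sublist l → z < x → z < y ∧ y < x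

theorem InversionsConvex.sublist {l l' : List ℕ} (h : InversionsConvex l) (hs : l'.Sublist l) :
    InversionsConvex l' := fun x y z hx => h x y z (hx.trans hs)

theorem InversionsConvex.noRise_reverse {l : List ℕ} (h : InversionsConvex l) :
    NoRise l.reverse := by
  intro a b x hs hba
  have hs' : [x, b, a].Sublist l := by simpa using hs.reverse
  by_contra hc
  have := h x b a hs' (by omega)
  omega

theorem inversionsConvex_layersFrom (as : List ℕ) : ∀ c, InversionsConvex (layersFrom c as) := by
  induction as with
  | nil => intro c x y z h; simp [layersFrom] at h
  | cons a t ih =>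
    intro c x y z h hzx
    rw [layersFrom, List.sublist_append_iff] at h
    obtain ⟨l₁, l₂, e, h1, h2⟩ := h
    have hdec : (List.range' (c + 1) a).reverse.Pairwise (· > ·) := by
      rw [List.pairwise_reverse]; exact List.pairwise_lt_range'
    have m1 : ∀ u ∈ l₁, u ≤ c + a := fun u hu => by
      have := h1.subset hu
      simp [List.mem_range'_1] at this; omega
    have m2 : ∀ u ∈ l₂, c + a < u := fun u hu => (mem_layersFrom.1 (h2.subset hu)).1
    rcases l₁ with _ | ⟨p, l₁⟩
    · rw [List.nil_append] at e
      exact ih _ x y z (e ▸ h2) hzx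
    rw [List.cons_append, List.cons.injEq] at e
    obtain ⟨rfl, e⟩ := e
    have hx := m1 x (by simp)
    -- As `z < x`, the entry `z` cannot lie in a later layer than `x`; all three entries then share
    -- one decreasing layer.
    have hz : z ∈ l₁ := by
      have : z ∈ l₁ ++ l₂ := by rw [← e]; simp
      refine (List.mem_append.1 this).resolve_right fun hz => ?_
      have := m2 z hz
      omega
    obtain rfl : l₂ = [] := by
      rcases List.eq_nil_or_concat l₂ with rfl | ⟨l, q, rfl⟩
      · rfl
      · exfalso
        have : z = q := by
          have := congrArg List.getLast? e
          simpa using this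
        have := m2 q (by simp)
        have := m1 z (by simp [hz])
        omega
    rw [List.append_nil] at e
    subst e
    have := hdec.sublist h1
    simp at this
    omega

theorem normalization_triple (x y z : ℕ) : normalization [x, y, z] =
    [1 + (if y ≤ x then 1 else 0) + (if z ≤ x then 1 else 0),
     (if x ≤ y then 1 else 0) + 1 + (if z ≤ y then 1 else 0),
     (if x ≤ z then 1 else 0) + (if y ≤ z then 1 else 0) + 1] := by
  simp [normalization, List.countP_cons]
  omega

theorem containsPattern_triple_iff {π : List ℕ} {a b c : ℕ} : ContainsPattern π [a, b, c] ↔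
    ∃ x y z, [x, y, z].Sublist π ∧ normalization [x, y, z] = normalization [a, b, c] := by
  constructor
  · rintro ⟨w, hw, e⟩
    have hl : w.length = 3 := by simpa [normalization] using congrArg List.length e
    obtain ⟨x, y, z, rfl⟩ := List.length_eq_three.1 hl
    exact ⟨x, y, z, hw, e⟩
  · rintro ⟨x, y, z, h⟩
    exact ⟨_, h⟩

theorem containsPattern_231_iff {π : List ℕ} :
    ContainsPattern π [2, 3, 1] ↔ ∃ x y z, [x, y, z].Sublist π ∧ z < x ∧ x < y := by
  rw [containsPattern_triple_iff]
  refine exists_congr fun x => exists_congr fun y => exists_congr fun z =>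
    and_congr_right fun _ => ?_
  rw [normalization_triple, show normalization [2, 3, 1] = [2, 3, 1] from rfl]
  -- Each comparison becomes a 0/1 unknown tied to its inequality, leaving a linear problem for
  -- `omega`.
  have e : ∀ a b : ℕ, ∃ i, (if a ≤ b then 1 else 0) = i ∧ (i = 1 ∧ a ≤ b ∨ i = 0 ∧ b < a) :=
    fun a b => ⟨_, rfl, by split_ifs <;> omega⟩
  obtain ⟨i, ei, hi⟩ := e y x
  obtain ⟨i', ei', hi'⟩ := e x y
  obtain ⟨j, ej, hj⟩ := e z x
  obtain ⟨j', ej', hj'⟩ := e x z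
  obtain ⟨l, el, hl⟩ := e z y
  obtain ⟨l', el', hl'⟩ := e y z
  simp only [ei, ei', ej, ej', el, el', List.cons.injEq, and_true]
  omega

theorem containsPattern_312_iff {π : List ℕ} :
    ContainsPattern π [3, 1, 2] ↔ ∃ x y z, [x, y, z].Sublist π ∧ y < z ∧ z < x := by
  rw [containsPattern_triple_iff]
  refine exists_congr fun x => exists_congr fun y => exists_congr fun z =>
    and_congr_right fun _ => ?_
  rw [normalization_triple, show normalization [3, 1, 2] = [3, 1, 2] from rfl]
  have e : ∀ a b : ℕ, ∃ i, (if a ≤ b then 1 else 0) = i ∧ (i = 1 ∧ a ≤ b ∨ i = 0 ∧ b < a) :=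
    fun a b => ⟨_, rfl, by split_ifs <;> omega⟩
  obtain ⟨i, ei, hi⟩ := e y x
  obtain ⟨i', ei', hi'⟩ := e x y
  obtain ⟨j, ej, hj⟩ := e z x
  obtain ⟨j', ej', hj'⟩ := e x z
  obtain ⟨l, el, hl⟩ := e z y
  obtain ⟨l', el', hl'⟩ := e y z
  simp only [ei, ei', ej, ej', el, el', List.cons.injEq, and_true]
  omega

theorem inversionsConvex_iff {π : List ℕ} (hd : π.Nodup) : InversionsConvex π ↔
    ¬ ContainsPattern π [2, 3, 1] ∧ ¬ ContainsPattern π [3, 1, 2] := by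
  rw [containsPattern_231_iff, containsPattern_312_iff]
  constructor
  · refine fun h => ⟨?_, ?_⟩
    · rintro ⟨x, y, z, hs, h1, h2⟩
      have := h x y z hs h1; omega
    · rintro ⟨x, y, z, hs, h1, h2⟩
      have := h x y z hs h2; omega
  · rintro ⟨h1, h2⟩ x y z hs hzx
    have hn := hd.sublist hs
    simp at hn
    have n1 : ¬ x < y := fun h => h1 ⟨x, y, z, hs, hzx, h⟩
    have n2 : ¬ y < z := fun h => h2 ⟨x, y, z, hs, h, hzx⟩
    omega

theorem eq_filter_append_filter {p : ℕ} {t : List ℕ} (h : t.Pairwise fun x y => y < p → x < p) :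
    t = t.filter (· < p) ++ t.filter (¬ · < p) := by
  induction t with
  | nil => rfl
  | cons a t ih =>
    rw [List.pairwise_cons] at h
    by_cases ha : a < p
    · conv_lhs => rw [ih h.2]
      simp [ha]
    · have : t.filter (· < p) = [] := by
        rw [List.filter_eq_nil_iff]
        intro y hy hyp
        exact ha (h.1 y hy (by simpa using hyp))
      have e := ih h.2
      rw [this, List.nil_append] at e
      rw [List.filter_cons_of_neg (by simpa using ha), List.filter_cons_of_pos (by simpa using ha),
        this, List.nil_append, ← e]

/-- Convexity of the inversions starting at the first entry `c + a` puts all smaller entries right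
after it, in decreasing order. They form the first layer, and induction handles the rest. -/
theorem exists_eq_layersFrom {m c : ℕ} {π : List ℕ} (hp : π.Perm (List.range' (c + 1) m))
    (h : InversionsConvex π) : ∃ as : List ℕ, (∀ x ∈ as, 0 < x) ∧ π = layersFrom c as := by
  induction m using Nat.strong_induction_on generalizing c π with
  | _ m ih =>
    rcases π with _ | ⟨p, t⟩
    · exact ⟨[], by simp, rfl⟩
    have hmem : ∀ x, x ∈ p :: t ↔ c < x ∧ x ≤ c + m := fun x => by
      rw [hp.mem_iff, List.mem_range'_1]; omega
    have hd : (p :: t).Nodup := hp.nodup_iff.2 List.nodup_range'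
    have hd' := List.nodup_cons.1 hd
    obtain ⟨a, rfl⟩ : ∃ a, p = c + a := ⟨p - c, by have := (hmem p).1 (by simp); omega⟩
    have ha := (hmem (c + a)).1 (by simp)
    have hsplit : t = t.filter (· < c + a) ++ t.filter (¬ · < c + a) := by
      apply eq_filter_append_filter
      rw [List.pairwise_iff_forall_sublist]
      intro x y hs hy
      exact (h _ x y (hs.cons_cons _) hy).2
    have hfirst : (c + a) :: t.filter (· < c + a) = (List.range' (c + 1) a).reverse := by
      have pw : ((c + a) :: t.filter (· < c + a)).Pairwise (· > ·) := by
        rw [List.pairwise_cons]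
        refine ⟨fun x hx => by simpa using (List.mem_filter.1 hx).2, ?_⟩
        rw [List.pairwise_iff_forall_sublist]
        intro x y hs
        have hy : y < c + a := by simpa using (List.mem_filter.1 (hs.subset (by simp : y ∈ _))).2
        exact (h _ x y ((hs.trans List.filter_sublist).cons_cons _) hy).1
      have pw' : (List.range' (c + 1) a).reverse.Pairwise (· > ·) := by
        rw [List.pairwise_reverse]; exact List.pairwise_lt_range'
      refine List.Perm.eq_of_pairwise (fun _ _ _ _ h1 h2 => absurd h1 (not_lt_of_gt h2)) pw pw' ?_
      rw [List.perm_ext_iff_of_nodup (hd.sublist (List.filter_sublist.cons_cons _))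
        (List.nodup_reverse.2 List.nodup_range')]
      intro x
      have := hmem x
      simp only [List.mem_cons, List.mem_filter, List.mem_reverse, List.mem_range'_1,
        decide_eq_true_eq] at this ⊢
      grind
    have hrest : (t.filter (¬ · < c + a)).Perm (List.range' (c + a + 1) (m - a)) := by
      rw [List.perm_ext_iff_of_nodup (hd'.2.sublist List.filter_sublist) List.nodup_range']
      intro x
      have := hmem x
      simp only [List.mem_cons, List.mem_filter, List.mem_range'_1,
        decide_eq_true_eq] at this ⊢
      grind
    obtain ⟨as, has, e⟩ := ih (m - a) (by omega) hrest
      (h.sublist (List.filter_sublist.trans (List.sublist_cons_self _ _)))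
    refine ⟨a :: as, by simpa using ⟨by omega, has⟩, ?_⟩
    rw [layersFrom, ← e, ← hfirst, List.cons_append, ← hsplit]

theorem isLayered_iff_of_mem_permutationsOf {n : ℕ} {π : List ℕ} (hπ : π ∈ permutationsOf n) :
    IsLayered π ↔ ¬ ContainsPattern π [2, 3, 1] ∧ ¬ ContainsPattern π [3, 1, 2] := by
  have hp : π.Perm (List.range' (0 + 1) n) := hπ
  rw [← inversionsConvex_iff (hp.nodup_iff.2 List.nodup_range'), isLayered_iff]
  refine ⟨?_, exists_eq_layersFrom hp⟩
  rintro ⟨as, -, rfl⟩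
  exact inversionsConvex_layersFrom as 0

/-! ### Inverses of layered permutations, and `DL` as comparison words. -/

theorem map_idxOf_reverse_range' (s d a : ℕ) :
    (List.range' s a).map (fun j => d + (List.range' s a).reverse.idxOf j + 1) =
      (List.range' (d + 1) a).reverse := by
  apply List.ext_getElem (by simp)
  intro i h1 h2
  have hi : i < a := by simpa using h1
  have hget : (List.range' s a).reverse[a - 1 - i]'(by simp; omega) = s + i := by
    simp; omega
  have hidx : (List.range' s a).reverse.idxOf (s + i) = a - 1 - i := by
    rw [← hget]
    exact (List.nodup_reverse.2 List.nodup_range').idxOf_getElem _ _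
  simp only [List.getElem_map, List.getElem_range', List.getElem_reverse, List.length_range',
    one_mul, hidx]
  omega

/-- Each layer occupies the positions equal to its values and is reversed there, hence is an
involution. The offset `c` lets the induction pass to later layers. -/
theorem map_idxOf_layersFrom (as : List ℕ) : ∀ c,
    (List.range' (c + 1) as.sum).map (fun j => c + (layersFrom c as).idxOf j + 1) =
      layersFrom c as := by
  induction as with
  | nil => intro c; rfl
  | cons a t ih =>
    intro c
    rw [List.sum_cons, ← List.range'_append_1, List.map_append, layersFrom]
    congr 1
    · refine Eq.trans ?_ (map_idxOf_reverse_range' (c + 1) c a)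
      refine List.map_congr_left fun j hj => ?_
      rw [List.idxOf_append_of_mem (by simpa using hj)]
    · conv_rhs => rw [← ih (c + a)]
      rw [show c + 1 + a = c + a + 1 by omega]
      refine List.map_congr_left fun j hj => ?_
      rw [List.idxOf_append_of_notMem]
      · simp; omega
      · simp only [List.mem_reverse, List.mem_range'_1] at hj ⊢
        omega

theorem inversePerm_layersFrom (as : List ℕ) : inversePerm (layersFrom 0 as) = layersFrom 0 as := by
  conv_rhs => rw [← map_idxOf_layersFrom as 0]
  simp [inversePerm, length_layersFrom]

theorem getElem_comparisonWord (l : List ℕ) : ∀ (i : ℕ) (h : i < (comparisonWord l).length),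
    (comparisonWord l)[i] = if l.getD (i + 1) 0 < l.getD i 0 then U else D := by
  induction l with
  | nil => intro i h; simp [comparisonWord] at h
  | cons a l ih =>
    rcases l with _ | ⟨b, l⟩
    · intro i h; simp [comparisonWord] at h
    · rintro (_ | i) h
      · simp [comparisonWord]
      · have := ih i (by simpa [comparisonWord] using h)
        simpa [comparisonWord] using this

theorem DL_fst {k : ℕ} {π : List ℕ} (hl : π.length = 2 * k + 1) (hd : π.Nodup) :
    (DL k π).1 = comparisonWord π.reverse := by
  apply List.ext_getElem (by simp [DL, length_comparisonWord, hl])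
  intro i h1 h2
  have hi : i < 2 * k := by simpa [DL] using h1
  rw [getElem_comparisonWord, List.getD_eq_getElem _ _ (by simp; omega),
    List.getD_eq_getElem _ _ (by simp; omega)]
  -- Distinctness is needed because a non-descent of `π` must be a strict descent of the reversed
  -- word.
  have hne : π[2 * k - i - 1]'(by omega) ≠ π[2 * k - i]'(by omega) := by
    rw [Ne, hd.getElem_inj_iff]; omega
  have e1 : entry π (2 * k + 1 - (1 + i) + 1) = π[2 * k - i]'(by omega) := by
    rw [entry, List.getD_eq_getElem _ _ (by omega)]
    congr 1; omega
  have e2 : entry π (2 * k + 1 - (1 + i)) = π[2 * k - i - 1]'(by omega) := by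
    rw [entry, List.getD_eq_getElem _ _ (by omega)]
    congr 1; omega
  have e3 : π.length - 1 - (i + 1) = 2 * k - i - 1 := by omega
  have e4 : π.length - 1 - i = 2 * k - i := by omega
  simp only [DL, List.getElem_map, List.getElem_range', one_mul, descents, Finset.mem_filter,
    Finset.mem_Icc, e1, e2, List.getElem_reverse, e3, e4]
  split_ifs <;> first | rfl | omega

theorem DL_snd {k : ℕ} {π : List ℕ} (hl : π.length = 2 * k + 1) :
    (DL k π).2 = comparisonWord (rot π) := by
  have hr : (rot π).length = 2 * k + 1 := by simp [rot, inversePerm, hl]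
  apply List.ext_getElem (by simp [DL, length_comparisonWord, hr])
  intro i h1 h2
  have hi : i < 2 * k := by simpa [DL] using h1
  rw [getElem_comparisonWord]
  have e : 1 + i - 1 = i := by omega
  have e' : 1 + i + 1 - 1 = i + 1 := by omega
  simp only [DL, List.getElem_map, List.getElem_range', one_mul, descents, Finset.mem_filter,
    Finset.mem_Icc, entry, hr, e, e']
  split_ifs <;> first | rfl | omega

/-! ### Compositions encoded as words. -/

theorem comparisonWord_append_of_lt {A B : List ℕ} (hA : A ≠ []) (hB : B ≠ [])
    (h : ∀ a ∈ A, ∀ b ∈ B, b < a) :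
    comparisonWord (A ++ B) = comparisonWord A ++ U :: comparisonWord B := by
  obtain ⟨A, a, rfl⟩ := (List.eq_nil_or_concat A).resolve_left hA
  obtain ⟨b, B, rfl⟩ := List.exists_cons_of_ne_nil hB
  simpa [h a (by simp) b (by simp)] using comparisonWord_append_cons_cons A B a b

theorem comparisonWord_range' (a : ℕ) : ∀ s,
    comparisonWord (List.range' s (a + 1)) = List.replicate a D := by
  induction a with
  | zero => intro s; rfl
  | succ a ih =>
    intro s
    have := ih (s + 1)
    rw [List.range'_succ] at this ⊢
    rw [List.range'_succ, comparisonWord, this, if_neg (by omega)]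
    rfl

/-- The reversed comparison word of `δ_{a_1} ⊕ ⋯ ⊕ δ_{a_m}`. -/
def layerWord : List ℕ → List DyckStep
  | [] => []
  | [a] => List.replicate (a - 1) D
  | a :: b :: t => layerWord (b :: t) ++ U :: List.replicate (a - 1) D

theorem comparisonWord_reverse_layersFrom (as : List ℕ) (h : ∀ x ∈ as, 0 < x) : ∀ c,
    comparisonWord (layersFrom c as).reverse = layerWord as := by
  induction as with
  | nil => intro c; rfl
  | cons a t ih =>
    intro c
    obtain ⟨a, rfl⟩ : ∃ a', a = a' + 1 := ⟨a - 1, by have := h a (by simp); omega⟩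
    have ih := ih (fun x hx => h x (by simp [hx]))
    rcases t with _ | ⟨b, t⟩
    · simp [layersFrom, layerWord, comparisonWord_range']
    · have hb : 0 < b := h b (by simp)
      rw [layersFrom, List.reverse_append, List.reverse_reverse, comparisonWord_append_of_lt, ih,
        comparisonWord_range', layerWord, Nat.add_sub_cancel]
      · rw [← List.length_pos_iff, List.length_reverse, length_layersFrom]
        simp; omega
      · simp
      · intro x hx y hy
        rw [List.mem_reverse, mem_layersFrom] at hx
        rw [List.mem_range'_1] at hy
        omega

/-- The first layer is read last: appending `U` adds a layer of size 1 in front, and appending `D`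
enlarges the first layer. Nonemptiness matters, since `[]` and `[1]` both give the empty word. -/
theorem exists_layerWord_eq (w : List DyckStep) :
    ∃ as : List ℕ, as ≠ [] ∧ (∀ x ∈ as, 0 < x) ∧ layerWord as = w := by
  induction w using List.reverseRecOn with
  | nil => exact ⟨[1], by simp, by simp, rfl⟩
  | append_singleton w s ih =>
    obtain ⟨as, hne, hpos, rfl⟩ := ih
    obtain ⟨a, t, rfl⟩ := List.exists_cons_of_ne_nil hne
    cases s with
    | U => exact ⟨1 :: a :: t, by simp, by simpa using hpos, by simp [layerWord]⟩
    | D =>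
      obtain ⟨a, rfl⟩ : ∃ a', a = a' + 1 := ⟨a - 1, by have := hpos a (by simp); omega⟩
      refine ⟨(a + 2) :: t, by simp, by simpa using fun x hx => hpos x (by simp [hx]), ?_⟩
      rcases t with _ | ⟨b, t⟩ <;> simp [layerWord, List.replicate_succ']

/-- The last `U` of a word determines the final run of `D`s, that is, the size of the first layer.
-/
theorem replicate_append_cons_inj {m m' : ℕ} {X Y : List DyckStep}
    (h : X ++ U :: List.replicate m D = Y ++ U :: List.replicate m' D) : m = m' ∧ X = Y := by
  induction m generalizing m' with
  | zero =>
    cases m' with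
    | zero => simpa using h
    | succ m' =>
      rw [List.replicate_succ', ← List.cons_append, ← List.append_assoc] at h
      simpa using (List.append_inj' h rfl).2
  | succ m ih =>
    cases m' with
    | zero =>
      rw [List.replicate_succ', ← List.cons_append, ← List.append_assoc] at h
      simpa using (List.append_inj' h rfl).2
    | succ m' =>
      rw [List.replicate_succ', List.replicate_succ', ← List.cons_append, ← List.cons_append,
        ← List.append_assoc, ← List.append_assoc] at h
      have := ih (List.append_inj' h rfl).1
      exact ⟨by omega, this.2⟩

theorem layerWord_injective {as bs : List ℕ} (ha : as ≠ []) (hb : bs ≠ [])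
    (hpa : ∀ x ∈ as, 0 < x) (hpb : ∀ x ∈ bs, 0 < x) (h : layerWord as = layerWord bs) :
    as = bs := by
  induction as generalizing bs with
  | nil => exact absurd rfl ha
  | cons a t ih =>
    obtain ⟨b, s, rfl⟩ := List.exists_cons_of_ne_nil hb
    have h1 := hpa a (by simp)
    have h2 := hpb b (by simp)
    rcases t with _ | ⟨a', t⟩ <;> rcases s with _ | ⟨b', s⟩
    · have := congrArg List.length h
      simp [layerWord] at this ⊢
      omega
    · have := congrArg (List.count U) h
      simp [layerWord, List.count_replicate] at this
    · have := congrArg (List.count U) h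
      simp [layerWord, List.count_replicate] at this
    · obtain ⟨e1, e2⟩ := replicate_append_cons_inj h
      rw [ih (by simp) (by simp) (fun x hx => hpa x (List.mem_cons_of_mem _ hx))
        (fun x hx => hpb x (List.mem_cons_of_mem _ hx)) e2, show a = b by omega]

/-! ### Dyck words, the bijection and the count. -/

theorem mem_uniquelySorted_231_312_iff {n : ℕ} {π : List ℕ} :
    π ∈ uniquelySorted n [[2, 3, 1], [3, 1, 2]] ↔
      π ∈ permutationsOf n ∧ IsUniquelySorted π ∧ IsLayered π := by
  have : π ∈ uniquelySorted n [[2, 3, 1], [3, 1, 2]] ↔ π ∈ permutationsOf n ∧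
      IsUniquelySorted π ∧ ¬ ContainsPattern π [2, 3, 1] ∧ ¬ ContainsPattern π [3, 1, 2] := by
    simp [uniquelySorted]
    tauto
  rw [this]
  refine and_congr_right fun hπ => ?_
  rw [isLayered_iff_of_mem_permutationsOf hπ]

theorem DL_layersFrom {k : ℕ} {as : List ℕ} (hp : ∀ x ∈ as, 0 < x) (hs : as.sum = 2 * k + 1) :
    DL k (layersFrom 0 as) = (layerWord as, layerWord as) := by
  have hl : (layersFrom 0 as).length = 2 * k + 1 := by rw [length_layersFrom, hs]
  have hd : (layersFrom 0 as).Nodup := (layersFrom_perm as 0).nodup_iff.2 List.nodup_range'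
  apply Prod.ext
  · rw [DL_fst hl hd, comparisonWord_reverse_layersFrom as hp]
  · rw [DL_snd hl, rot, inversePerm_layersFrom, comparisonWord_reverse_layersFrom as hp]

theorem isUniquelySorted_layersFrom_iff {as : List ℕ} (hp : ∀ x ∈ as, 0 < x) (hs : as.sum ≠ 0) :
    IsUniquelySorted (layersFrom 0 as) ↔
      IsBallot (layerWord as) ∧ (layerWord as).count D = (layerWord as).count U := by
  have hd : (layersFrom 0 as).Nodup := (layersFrom_perm as 0).nodup_iff.2 List.nodup_range'
  have := isUniquelySorted_reverse_iff (l := (layersFrom 0 as).reverse)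
    (by rw [← List.length_pos_iff, List.length_reverse, length_layersFrom]; omega)
    (List.nodup_reverse.2 hd)
    (fun x hx => by rw [List.mem_reverse, mem_layersFrom] at hx; omega)
    (inversionsConvex_layersFrom as 0).noRise_reverse
  rwa [List.reverse_reverse, comparisonWord_reverse_layersFrom as hp] at this

theorem length_layerWord {as : List ℕ} (hp : ∀ x ∈ as, 0 < x) :
    (layerWord as).length = as.sum - 1 := by
  rw [← comparisonWord_reverse_layersFrom as hp 0, length_comparisonWord, List.length_reverse,
    length_layersFrom]

theorem DyckWord.length_toList (p : DyckWord) : p.toList.length = 2 * p.semilength := by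
  have := p.two_mul_semilength_eq_length
  omega

theorem mem_uniquelySorted_231_312_iff_exists {k : ℕ} {π : List ℕ} :
    π ∈ uniquelySorted (2 * k + 1) [[2, 3, 1], [3, 1, 2]] ↔
      ∃ as : List ℕ, as ≠ [] ∧ (∀ x ∈ as, 0 < x) ∧ as.sum = 2 * k + 1 ∧ π = layersFrom 0 as ∧
        ∃ p : DyckWord, p.semilength = k ∧ p.toList = layerWord as := by
  rw [mem_uniquelySorted_231_312_iff]
  constructor
  · rintro ⟨hπ, hu, hL⟩
    obtain ⟨as, hp, rfl⟩ := isLayered_iff.1 hL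
    have hs : as.sum = 2 * k + 1 := by
      rw [← length_layersFrom 0, List.Perm.length_eq hπ, List.length_range']
    rw [isUniquelySorted_layersFrom_iff hp (by omega)] at hu
    refine ⟨as, by rintro rfl; simp at hs, hp, hs, rfl, ⟨_, hu.2.symm, hu.1⟩, ?_, rfl⟩
    have := DyckWord.length_toList ⟨_, hu.2.symm, hu.1⟩
    rw [length_layerWord hp] at this
    omega
  · rintro ⟨as, -, hp, hs, rfl, p, -, hw⟩
    refine ⟨by simpa [permutationsOf, hs] using layersFrom_perm as 0, ?_,
      isLayered_iff.2 ⟨as, hp, rfl⟩⟩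
    rw [isUniquelySorted_layersFrom_iff hp (by omega), ← hw]
    exact ⟨p.count_D_le_count_U, p.count_U_eq_count_D.symm⟩

theorem mem_antichainIntervals_iff {k : ℕ} {w : List DyckStep × List DyckStep} :
    w ∈ antichainIntervals k ↔
      ∃ p : DyckWord, p.semilength = k ∧ w = (p.toList, p.toList) := by
  constructor
  · rintro ⟨x, y, hxy, rfl⟩
    obtain rfl : x = y := hxy
    exact ⟨x.path, x.semilength_eq, rfl⟩
  · rintro ⟨p, hp, rfl⟩
    exact ⟨⟨p, hp⟩, ⟨p, hp⟩, le_rfl, rfl⟩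

theorem ncard_antichainIntervals (k : ℕ) : (antichainIntervals k).ncard = catalan k := by
  have e : antichainIntervals k = Set.range
      fun p : {p : DyckWord // p.semilength = k} => (p.1.toList, p.1.toList) := by
    ext w
    rw [mem_antichainIntervals_iff]
    simp [eq_comm]
  rw [e, Set.ncard_range_of_injective, Nat.card_eq_fintype_card,
    DyckWord.card_dyckWord_semilength_eq_catalan]
  intro p q h
  exact Subtype.ext (DyckWord.ext (Prod.ext_iff.1 h).1)

theorem bijOn_DL (k : ℕ) :
    Set.BijOn (DL k) (uniquelySorted (2 * k + 1) [[2, 3, 1], [3, 1, 2]])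
      (antichainIntervals k) := by
  refine ⟨fun π hπ => ?_, fun π hπ π' hπ' h => ?_, fun w hw => ?_⟩
  · obtain ⟨as, -, hp, hs, rfl, p, hk, hw⟩ := mem_uniquelySorted_231_312_iff_exists.1 hπ
    rw [DL_layersFrom hp hs, ← hw]
    exact mem_antichainIntervals_iff.2 ⟨p, hk, rfl⟩
  · obtain ⟨as, hn, hp, hs, rfl, -⟩ := mem_uniquelySorted_231_312_iff_exists.1 hπ
    obtain ⟨bs, hn', hp', hs', rfl, -⟩ := mem_uniquelySorted_231_312_iff_exists.1 hπ'
    rw [DL_layersFrom hp hs, DL_layersFrom hp' hs'] at h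
    rw [layerWord_injective hn hn' hp hp' (Prod.ext_iff.1 h).1]
  · obtain ⟨p, hk, rfl⟩ := mem_antichainIntervals_iff.1 hw
    obtain ⟨as, hn, hp, e⟩ := exists_layerWord_eq p.toList
    have hs : as.sum = 2 * k + 1 := by
      have h1 := length_layerWord hp
      rw [e, p.length_toList, hk] at h1
      -- The length is `as.sum - 1` with truncated subtraction; a positive first layer rules out the
      -- sum 0 when `k = 0`.
      obtain ⟨a, t, rfl⟩ := List.exists_cons_of_ne_nil hn
      have := hp a (by simp)
      rw [List.sum_cons] at h1 ⊢
      omega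
    refine ⟨layersFrom 0 as, mem_uniquelySorted_231_312_iff_exists.2
      ⟨as, hn, hp, hs, rfl, p, hk, e.symm⟩, ?_⟩
    rw [DL_layersFrom hp hs, e]

theorem theorem9 (k : ℕ) :
    Set.BijOn (DL k) (uniquelySorted (2 * k + 1) [[2, 3, 1], [3, 1, 2]]) (antichainIntervals k) ∧
      (uniquelySorted (2 * k + 1) [[2, 3, 1], [3, 1, 2]]).ncard = catalan k ∧
      uniquelySorted (2 * k + 1) [[2, 3, 1], [3, 1, 2]] =
        {π | π ∈ uniquelySorted (2 * k + 1) [] ∧ IsLayered π} := by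
  refine ⟨bijOn_DL k, ?_, ?_⟩
  · rw [← ncard_antichainIntervals, ← (bijOn_DL k).image_eq,
      (bijOn_DL k).injOn.ncard_image]
  · ext π
    rw [mem_uniquelySorted_231_312_iff]
    simp [uniquelySorted, and_assoc]
    tauto
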